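/- All graphs are finite and simple. For a graph $G$ with $n$ vertices, let $X_G=\sum_{\kappa}\prod_{v\in V(G)}x_{\kappa(v)}$, summed over all proper colorings $\kappa:V(G)\to\mathbb{Z}^{+}$, be its chromatic symmetric function (a power series over $\mathbb{Q}$ in $x_1,x_2,\dots$), and let $\mathrm{Part}(G)\vdash n$ be the partition formed by the numbers of vertices of the connected components of $G$. For partitions $\mu,\lambda\vdash n$, say that $\mu$ is finer than $\lambda$ ($\mu\le\lambda$) if the parts of $\mu$ can be grouped into blocks such that replacing each block by its sum gives $\lambda$. Let $B=\{X_{G_\lambda}\mid\lambda\vdash n\}$ be a forest-basis: to every partition $\lambda\vdash n$ there is assigned a forest $G_\lambda$ with $\mathrm{Part}(G_\lambda)=\lambda$. Then the following hold for every graph $G$ with $n$ vertices. 0. The family $(X_{G_\mu})_{\mu\vdash n}$ is linearly independent over $\mathbb{Q}$ and $X_G$ lies in its $\mathbb{Q}$-span, so that there are unique coefficients $[\mu]X_{G,B}\in\mathbb{Q}$ with $X_G=\sum_{\mu\vdash n}[\mu]X_{G,B}\,X_{G_\mu}$. 1. If $\mu\vdash n$ and $[\mu]X_{G,B}\neq 0$,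 then $\mu\le\mathrm{Part}(G)$. 2. If $G=F$ is a forest with $\mathrm{Part}(F)=\lambda$, then $[\lambda]X_{F,B}=1$. -/

import Mathlib

universe u v

namespace ForestBasis

/-- The monomial `∏ᵥ x_{κ v}`, recorded by its exponent vector. -/
noncomputable def colorMonomial {V : Type v} [Fintype V] (κ : V → ℕ+) : ℕ+ →₀ ℕ :=
  ∑ v, Finsupp.single (κ v) 1

/-- Only finitely many colorings have a given monomial, so the coefficients of the chromatic
symmetric function below are honest cardinalities. -/
theorem finite_colorings {V : Type v} [Fintype V] (G : SimpleGraph V) (m : ℕ+ →₀ ℕ) :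
    Finite {κ : G.Coloring ℕ+ // colorMonomial (fun v => κ v) = m} := by
  classical
  refine Finite.of_injective
    (β := V → m.support)
    (fun κ v => ⟨κ.1 v, ?_⟩) ?_
  · rw [Finsupp.mem_support_iff]
    intro h
    have h0 := DFunLike.congr_fun κ.2 (κ.1 v)
    rw [h, colorMonomial, Finsupp.finsetSum_apply] at h0
    have h1 := (Finset.sum_eq_zero_iff.mp h0) v (Finset.mem_univ v)
    simp at h1
  · intro κ κ' h
    apply Subtype.ext
    apply DFunLike.ext
    intro v
    exact congrArg Subtype.val (congrFun h v)

/-- The chromatic symmetric function `X_G = ∑_κ ∏ᵥ x_{κ v}`, the sum over all proper colorings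
`κ : V → ℤ⁺`, as a formal power series over `ℚ` in the variables `x₁, x₂, …`: the coefficient of
a monomial is the number of proper colorings with that monomial. -/
noncomputable def csf {V : Type v} [Fintype V] (G : SimpleGraph V) : MvPowerSeries ℕ+ ℚ :=
  fun m => (Nat.card {κ : G.Coloring ℕ+ // colorMonomial (fun v => κ v) = m} : ℚ)

open Classical in
/-- `Part(G)`: the partition of `n = |V|` formed by the sizes of the connected components. -/
noncomputable def part {V : Type v} [Fintype V] (G : SimpleGraph V) {n : ℕ}
    (hn : Fintype.card V = n) : n.Partition where
  parts := (Finset.univ : Finset G.ConnectedComponent).val.map fun c => c.supp.ncard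
  parts_pos := by
    intro i hi
    obtain ⟨c, -, rfl⟩ := Multiset.mem_map.mp hi
    exact (Set.ncard_pos (Set.toFinite _)).mpr c.nonempty_supp
  parts_sum := by
    change ∑ c : G.ConnectedComponent, c.supp.ncard = n
    rw [← hn, ← Finset.card_univ, Finset.card_eq_sum_card_fiberwise
      (f := G.connectedComponentMk) (t := Finset.univ) (by simp)]
    refine Finset.sum_congr rfl fun c _ => ?_
    rw [← Set.ncard_coe_finset]
    congr 1
    ext v
    simp

/-- `μ` is finer than `lam` (`μ ≤ lam`): the parts of `μ` can be grouped into blocks so that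
replacing each block by its sum gives `lam`. -/
def IsFiner {n : ℕ} (μ lam : n.Partition) : Prop :=
  ∃ S : Multiset (Multiset ℕ), S.join = μ.parts ∧ S.map Multiset.sum = lam.parts

/-- A chromatic-basis: an assignment of a graph `G_lam` with `Part(G_lam) = lam` to every
partition `lam` of `n`. The basis itself is the family `X_{G_lam}`, see `ChromaticBasis.elt`. -/
structure ChromaticBasis (n : ℕ) where
  V : n.Partition → Type u
  fintypeV : ∀ lam, Fintype (V lam)
  graph : ∀ lam, SimpleGraph (V lam)
  card_V : ∀ lam, Fintype.card (V lam) = n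
  part_graph : ∀ lam, part (graph lam) (card_V lam) = lam

attribute [instance] ChromaticBasis.fintypeV

namespace ChromaticBasis

variable {n : ℕ}

/-- The member `X_{G_lam}` of the chromatic-basis. -/
noncomputable def elt (B : ChromaticBasis.{u} n) (lam : n.Partition) : MvPowerSeries ℕ+ ℚ :=
  csf (B.graph lam)

/-- A forest-basis is a chromatic-basis all of whose graphs are forests. -/
def IsForestBasis (B : ChromaticBasis.{u} n) : Prop :=
  ∀ lam, (B.graph lam).IsAcyclic

/-- `c` is a list of coefficients expressing `X_G` in the chromatic-basis `B`. -/
def IsExpansion (B : ChromaticBasis.{u} n) {V : Type v} [Fintype V] (G : SimpleGraph V)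
    (c : n.Partition → ℚ) : Prop :=
  csf G = ∑ lam, c lam • B.elt lam

open Classical in
/-- The coefficient `[μ] X_{G,B}` of `X_{G_μ}` in the expression of `X_G` in `B` (with the junk
value `0` if there is no such expression). -/
noncomputable def coeff (B : ChromaticBasis.{u} n) {V : Type v} [Fintype V] (G : SimpleGraph V)
    (μ : n.Partition) : ℚ :=
  if h : ∃ c, B.IsExpansion G c then h.choose μ else 0

end ChromaticBasis

end ForestBasis

/-! Inclusion–exclusion over edges (`csf_eq_sum_powerSum`) writes `X_G` as the sum of `(-1)^|S|
p_{Part(S)}` over edge sets `S`, and every `Part(S)` is finer than `Part(G)`. In a forest, edges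
plus components equals vertices, so only the full edge set yields `p_lam` with `lam = Part(F)`, with
sign `(-1)^(n - ℓ(lam))`; all other terms are strictly finer (`csf_sub_powerSum_mem_span`).

So a forest-basis is triangular over the power sums, with diagonal `±1`, for refinement. Inverting
preserves downward closed sets of partitions (`IsForestBasis.span_powerSum_le`). This gives
independence by dimension count, and the support claim from the partitions finer than `Part(G)`. For
a forest `F` of type `lam`, the leading terms of `X_F` and `X_{G_lam}` agree, so their difference
involves only strictly finer partitions. -/

namespace ForestBasis

/-! ### The refinement order on partitions. -/

section Refinement

/-- Summing a weight over the fibres of a map groups the weights into blocks. -/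
theorem IsFiner.of_fiberwise {n : ℕ} {μ lam : n.Partition} {ι κ : Type*} [Fintype ι] [Fintype κ]
    [DecidableEq κ] (f : ι → κ) (w : ι → ℕ) (hμ : Finset.univ.val.map w = μ.parts)
    (hlam : Finset.univ.val.map (fun k => ∑ i with f i = k, w i) = lam.parts) :
    IsFiner μ lam := by
  classical
  refine ⟨Finset.univ.val.map fun k => (Finset.univ.filter (f · = k)).val.map w, ?_, ?_⟩
  · rw [← hμ]
    ext a
    rw [Multiset.join, ← Finset.sum, Multiset.count_sum']
    simp only [Multiset.count_map]
    rw [← Finset.filter_val, Finset.card_val,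
      Finset.card_eq_sum_card_fiberwise (f := f) (t := Finset.univ) (by simp)]
    refine Finset.sum_congr rfl fun k _ => ?_
    rw [← Finset.filter_val, Finset.card_val]
    congr 1
    ext i
    simp [and_comm]
  · rw [← hlam, Multiset.map_map]
    rfl

theorem IsFiner.refl {n : ℕ} (μ : n.Partition) : IsFiner μ μ := by
  refine ⟨μ.parts.map fun a => {a}, ?_, ?_⟩
  · rw [Multiset.join, Multiset.sum_map_singleton]
  · simp

theorem exists_multiset_add_of_map_eq_add {α β : Type*} (f : α → β) (s : Multiset α)
    (t₁ t₂ : Multiset β) (h : s.map f = t₁ + t₂) :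
    ∃ s₁ s₂, s = s₁ + s₂ ∧ s₁.map f = t₁ ∧ s₂.map f = t₂ := by
  classical
  induction t₁ using Multiset.induction_on generalizing s with
  | empty => exact ⟨0, s, by simp, rfl, by simpa using h⟩
  | cons b t ih =>
    rw [Multiset.cons_add, ← Multiset.map_eq_cons] at h
    obtain ⟨a, ha, rfl, h⟩ := h
    obtain ⟨s₁, s₂, hs, rfl, rfl⟩ := ih _ h
    refine ⟨a ::ₘ s₁, s₂, ?_, by simp, rfl⟩
    rw [Multiset.cons_add, ← hs, Multiset.cons_erase ha]

/-- Lifts a grouping of block sums to a grouping of the blocks themselves, which is what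
transitivity of refinement needs. -/
theorem exists_join_of_map_eq_join {α β : Type*} (f : α → β) (s : Multiset α)
    (T : Multiset (Multiset β)) (h : s.map f = T.join) :
    ∃ S : Multiset (Multiset α), S.join = s ∧ S.map (Multiset.map f) = T := by
  induction T using Multiset.induction_on generalizing s with
  | empty => exact ⟨0, by simpa [eq_comm] using h, rfl⟩
  | cons t T ih =>
    rw [Multiset.join_cons] at h
    obtain ⟨s₁, s₂, rfl, rfl, h₂⟩ := exists_multiset_add_of_map_eq_add f s _ _ h
    obtain ⟨S, rfl, rfl⟩ := ih _ h₂
    exact ⟨s₁ ::ₘ S, by simp, by simp⟩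

theorem join_map_join {α : Type*} (S : Multiset (Multiset (Multiset α))) :
    (S.map Multiset.join).join = S.join.join := by
  induction S using Multiset.induction_on with
  | empty => rfl
  | cons s S ih => simp [ih]

theorem IsFiner.trans {n : ℕ} {μ ν ρ : n.Partition} (h₁ : IsFiner μ ν) (h₂ : IsFiner ν ρ) :
    IsFiner μ ρ := by
  obtain ⟨S, hS, hS'⟩ := h₁
  obtain ⟨T, hT, hT'⟩ := h₂
  obtain ⟨U, rfl, rfl⟩ := exists_join_of_map_eq_join _ S T (hS'.trans hT.symm)
  refine ⟨U.map Multiset.join, (join_map_join U).trans hS, ?_⟩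
  rw [← hT', Multiset.map_map, Multiset.map_map]
  refine Multiset.map_congr rfl fun s _ => ?_
  induction s using Multiset.induction_on with
  | empty => rfl
  | cons a s ih => simp

/-- A positive sum forces a block to be nonempty; if there are no more elements than blocks, every
block is a singleton. -/
theorem eq_join_of_card_join_le {S : Multiset (Multiset ℕ)} (hpos : ∀ s ∈ S, 0 < s.sum) :
    S.card ≤ S.join.card ∧ (S.join.card ≤ S.card → S.map Multiset.sum = S.join) := by
  induction S using Multiset.induction_on with
  | empty => simp
  | cons s S ih =>
    obtain ⟨h₁, h₂⟩ := ih fun t ht => hpos t (Multiset.mem_cons_of_mem ht)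
    have hs : 0 < s.card := by
      rw [Multiset.card_pos]
      rintro rfl
      simp at hpos
    simp only [Multiset.card_cons, Multiset.join_cons, Multiset.card_add, Multiset.map_cons]
    refine ⟨by omega, fun h => ?_⟩
    obtain ⟨a, rfl⟩ := Multiset.card_eq_one.mp (show s.card = 1 by omega)
    rw [h₂ (by omega)]
    simp

/-- A partition finer than `lam` has at least as many parts, strictly more if it differs. -/
theorem IsFiner.eq_or_card_lt {n : ℕ} {μ lam : n.Partition} (h : IsFiner μ lam) :
    μ = lam ∨ lam.parts.card < μ.parts.card := by
  obtain ⟨S, hS, hS'⟩ := h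
  have hpos : ∀ s ∈ S, 0 < s.sum := fun s hs =>
    lam.parts_pos (hS' ▸ Multiset.mem_map_of_mem _ hs)
  obtain ⟨-, h₂⟩ := eq_join_of_card_join_le hpos
  rw [hS, hS'] at h₂
  rw [← hS', Multiset.card_map]
  rw [or_iff_not_imp_right, not_lt]
  exact fun h => Nat.Partition.ext (h₂ h).symm

end Refinement

/-! ### Power sums and their linear independence. -/

section PowerSum

/-- The product of the power sums `p_{w i}`: the coefficient of a monomial is the number of ways
to colour the weighted points so as to obtain it. -/
noncomputable def weightedPowerSum {ι : Type*} [Fintype ι] (w : ι → ℕ) : MvPowerSeries ℕ+ ℚ :=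
  fun m => (Nat.card {g : ι → ℕ+ // ∑ i, Finsupp.single (g i) (w i) = m} : ℚ)

theorem exists_equiv_of_map_eq {ι κ : Type*} [Fintype ι] [Fintype κ] (w : ι → ℕ) (w' : κ → ℕ)
    (h : Finset.univ.val.map w = Finset.univ.val.map w') :
    ∃ e : ι ≃ κ, ∀ i, w' (e i) = w i := by
  classical
  have hc : ∀ k, Nonempty ({i // w i = k} ≃ {j // w' j = k}) := fun k => by
    rw [← Fintype.card_eq, Fintype.card_subtype, Fintype.card_subtype]
    have := congrArg (Multiset.count k) h
    rw [Multiset.count_map, Multiset.count_map, ← Finset.filter_val, ← Finset.filter_val,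
      Finset.card_val, Finset.card_val] at this
    simpa [eq_comm] using this
  exact ⟨Equiv.ofFiberEquiv fun k => (hc k).some, fun i => Equiv.ofFiberEquiv_map _ i⟩

theorem weightedPowerSum_congr {ι κ : Type*} [Fintype ι] [Fintype κ] (w : ι → ℕ) (w' : κ → ℕ)
    (h : Finset.univ.val.map w = Finset.univ.val.map w') :
    weightedPowerSum w = weightedPowerSum w' := by
  obtain ⟨e, he⟩ := exists_equiv_of_map_eq w w' h
  funext m
  refine congrArg Nat.cast (Nat.card_congr ((e.arrowCongr (Equiv.refl ℕ+)).subtypeEquiv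
    fun g => ?_))
  rw [← e.sum_comp fun j => Finsupp.single (e.arrowCongr (Equiv.refl ℕ+) g j) (w' j)]
  simp [he]

/-- The power sum symmetric function `p_μ`. -/
noncomputable def powerSum {n : ℕ} (μ : n.Partition) : MvPowerSeries ℕ+ ℚ :=
  weightedPowerSum fun i : μ.parts.ToType => i.1

theorem weightedPowerSum_eq_powerSum {n : ℕ} {μ : n.Partition} {ι : Type*} [Fintype ι]
    (w : ι → ℕ) (h : Finset.univ.val.map w = μ.parts) : weightedPowerSum w = powerSum μ :=
  weightedPowerSum_congr _ _ (h.trans (Multiset.map_univ_coe _).symm)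

/-- A monomial whose exponents are the parts of `μ`. -/
noncomputable def partMonomial {n : ℕ} (μ : n.Partition) : ℕ+ →₀ ℕ :=
  ∑ j : μ.parts.ToType, Finsupp.single ((Fintype.equivFin μ.parts.ToType j : ℕ).succPNat) j.1

theorem succPNat_equivFin_injective {α : Type*} [Fintype α] :
    Function.Injective fun j : α => (Fintype.equivFin α j : ℕ).succPNat := fun _ _ h =>
  (Fintype.equivFin α).injective (Fin.ext (Nat.succPNat_injective h))

/-- A nonzero coefficient provides a coloring of the parts of `lam`; each color class sums to the
exponent of its variable, and these exponents are the parts of `μ`. -/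
theorem isFiner_of_powerSum_partMonomial_ne_zero {n : ℕ} {lam μ : n.Partition}
    (h : powerSum lam (partMonomial μ) ≠ 0) : IsFiner lam μ := by
  classical
  obtain ⟨g, hg⟩ : Nonempty {g : lam.parts.ToType → ℕ+ //
      ∑ i, Finsupp.single (g i) i.1 = partMonomial μ} := by
    by_contra hne
    rw [not_nonempty_iff] at hne
    exact h (by simp [powerSum, weightedPowerSum, partMonomial] at hne ⊢)
  let e : μ.parts.ToType → ℕ+ := fun j => (Fintype.equivFin _ j : ℕ).succPNat
  have he : Function.Injective e := succPNat_equivFin_injective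
  have hg' : ∀ k, ∑ i with g i = k, i.1 = ∑ j with e j = k, j.1 := fun k => by
    have := DFunLike.congr_fun hg k
    simpa [partMonomial, Finsupp.finsetSum_apply, Finsupp.single_apply, Finset.sum_filter]
      using this
  have hmem : ∀ i, ∃ j, e j = g i := fun i => by
    by_contra! hne
    have h0 := hg' (g i)
    rw [Finset.filter_false_of_mem (s := Finset.univ) (p := fun j => e j = g i)
      fun j _ => hne j, Finset.sum_empty, Finset.sum_eq_zero_iff] at h0
    exact (lam.parts_pos (Multiset.coe_mem (x := i))).ne' (h0 i (by simp))
  choose f hf using hmem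
  refine IsFiner.of_fiberwise f (fun i => i.1) (Multiset.map_univ_coe _) ?_
  conv_rhs => rw [← Multiset.map_univ_coe μ.parts]
  refine Multiset.map_congr rfl fun j _ => ?_
  have hj := hg' (e j)
  simp only [he.eq_iff, ← hf] at hj
  refine hj.trans ?_
  rw [show (Finset.univ.filter fun x => x = j) = {j} by ext; simp, Finset.sum_singleton]

theorem powerSum_partMonomial_self_ne_zero {n : ℕ} (μ : n.Partition) :
    powerSum μ (partMonomial μ) ≠ 0 := by
  -- `Nat.card` is `0` on infinite types, so nonemptiness alone would not suffice.
  have hfin : Finite {g : μ.parts.ToType → ℕ+ //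
      ∑ i, Finsupp.single (g i) i.1 = partMonomial μ} := by
    refine Finite.of_injective (β := μ.parts.ToType → (partMonomial μ).support)
      (fun g i => ⟨g.1 i, ?_⟩) fun g g' h => ?_
    · rw [Finsupp.mem_support_iff]
      intro h0
      replace h0 := (DFunLike.congr_fun g.2 (g.1 i)).trans h0
      rw [Finsupp.finsetSum_apply] at h0
      have := Finset.sum_eq_zero_iff.mp h0 i (Finset.mem_univ i)
      rw [Finsupp.single_eq_same] at this
      exact (μ.parts_pos (Multiset.coe_mem (x := i))).ne' this
    · exact Subtype.ext (funext fun i => congrArg Subtype.val (congrFun h i))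
  have : Nonempty {g : μ.parts.ToType → ℕ+ //
      ∑ i, Finsupp.single (g i) i.1 = partMonomial μ} := ⟨⟨_, rfl⟩⟩
  exact Nat.cast_ne_zero.mpr Nat.card_pos.ne'

theorem linearIndependent_powerSum (n : ℕ) :
    LinearIndependent ℚ (powerSum : n.Partition → MvPowerSeries ℕ+ ℚ) := by
  rw [Fintype.linearIndependent_iff]
  intro c hc
  by_contra! hne
  -- With `μ` having the most parts in the support, any other contributing `lam` would be strictly
  -- finer and so have even more parts.
  obtain ⟨μ, hμ, hmax⟩ := (Finset.univ.filter fun μ : n.Partition => c μ ≠ 0).exists_max_image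
    (fun μ => μ.parts.card) (hne.imp fun μ hμ => by simpa using hμ)
  have h0 : ∑ lam, c lam * powerSum lam (partMonomial μ) = 0 := by
    have := congrArg (MvPowerSeries.coeff (R := ℚ) (partMonomial μ)) hc
    rw [map_sum, map_zero] at this
    simp only [map_smul] at this
    exact this
  rw [Finset.sum_eq_single_of_mem μ (Finset.mem_univ μ)] at h0
  · exact (mul_ne_zero (by simpa using hμ) (powerSum_partMonomial_self_ne_zero μ)) h0
  · intro lam _ hlam
    by_contra h
    obtain ⟨h₁, h₂⟩ := mul_ne_zero_iff.mp h
    have := hmax lam (by simpa using h₁)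
    rcases (isFiner_of_powerSum_partMonomial_ne_zero h₂).eq_or_card_lt with h | h
    · exact hlam h
    · omega

end PowerSum

/-! ### Edge subsets and the power sum expansion. -/

section Graph

open SimpleGraph

theorem sum_supp_ncard_fiberwise {V : Type*} [Fintype V] {H G : SimpleGraph V}
    [Fintype H.ConnectedComponent] [DecidableEq G.ConnectedComponent] (hle : H ≤ G)
    (c : G.ConnectedComponent) :
    ∑ d : H.ConnectedComponent with d.map (Hom.ofLE hle) = c, d.supp.ncard = c.supp.ncard := by
  classical
  rw [Set.ncard_eq_toFinset_card' c.supp, Finset.card_eq_sum_card_fiberwise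
    (f := H.connectedComponentMk)
    (t := Finset.univ.filter fun d => d.map (Hom.ofLE hle) = c)]
  · refine Finset.sum_congr rfl fun d hd => ?_
    rw [Set.ncard_eq_toFinset_card']
    congr 1
    ext v
    simp only [Finset.mem_filter, Finset.mem_univ, true_and] at hd
    simp only [Set.mem_toFinset, ConnectedComponent.mem_supp_iff, Finset.mem_filter]
    refine ⟨fun h => ⟨?_, h⟩, fun h => h.2⟩
    rw [← hd, ← h]
    rfl
  · intro v hv
    simpa using hv

theorem isFiner_part_of_le {V : Type*} [Fintype V] {n : ℕ} (hn : Fintype.card V = n)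
    {H G : SimpleGraph V} (hle : H ≤ G) : IsFiner (part H hn) (part G hn) := by
  classical
  exact IsFiner.of_fiberwise (ConnectedComponent.map (Hom.ofLE hle)) (fun d => d.supp.ncard) rfl
    (Multiset.map_congr rfl fun c _ => sum_supp_ncard_fiberwise hle c)

theorem card_parts_part {V : Type*} [Fintype V] {n : ℕ} (hn : Fintype.card V = n)
    (G : SimpleGraph V) : (part G hn).parts.card = Nat.card G.ConnectedComponent := by
  classical
  simp [part, Nat.card_eq_fintype_card]

/-- Colorings that are constant on the connected components are colorings of the components. -/
def constOnAdjEquiv {V : Type*} (H : SimpleGraph V) (C : Type*) :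
    {κ : V → C // ∀ u v, H.Adj u v → κ u = κ v} ≃ (H.ConnectedComponent → C) where
  toFun κ := ConnectedComponent.lift κ.1 fun u v p _ => by
    clear * - p
    induction p with
    | nil => rfl
    | cons h _ ih => exact (κ.2 _ _ h).trans ih
  invFun g := ⟨fun v => g (H.connectedComponentMk v), fun u v h =>
    congrArg g (ConnectedComponent.sound h.reachable)⟩
  left_inv κ := rfl
  right_inv g := funext fun c => c.ind fun _ => rfl

theorem colorMonomial_comp_connectedComponentMk {V : Type*} [Fintype V] (H : SimpleGraph V)
    [Fintype H.ConnectedComponent] (g : H.ConnectedComponent → ℕ+) :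
    colorMonomial (fun v => g (H.connectedComponentMk v)) =
      ∑ c, Finsupp.single (g c) c.supp.ncard := by
  classical
  rw [colorMonomial, ← Finset.sum_fiberwise Finset.univ H.connectedComponentMk]
  refine Finset.sum_congr rfl fun c _ => ?_
  rw [Finset.sum_congr rfl (g := fun _ => Finsupp.single (g c) 1)
    fun v hv => by rw [(Finset.mem_filter.mp hv).2], Finset.sum_const, Finsupp.smul_single,
    Set.ncard_eq_toFinset_card']
  congr 1
  simp only [smul_eq_mul, mul_one]
  congr 1
  ext v
  simp

theorem powerSum_part_apply {V : Type*} [Fintype V] {n : ℕ} (hn : Fintype.card V = n)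
    (H : SimpleGraph V) (m : ℕ+ →₀ ℕ) :
    powerSum (part H hn) m =
      Nat.card {κ : V → ℕ+ // (∀ u v, H.Adj u v → κ u = κ v) ∧ colorMonomial κ = m} := by
  classical
  rw [← weightedPowerSum_eq_powerSum (μ := part H hn)
    (fun c : H.ConnectedComponent => c.supp.ncard) rfl]
  refine congrArg Nat.cast (Nat.card_congr ?_)
  refine Equiv.trans ?_ (Equiv.subtypeSubtypeEquivSubtypeInter
    (fun κ : V → ℕ+ => ∀ u v, H.Adj u v → κ u = κ v) fun κ => colorMonomial κ = m)
  refine (constOnAdjEquiv H ℕ+).symm.subtypeEquiv fun g => ?_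
  rw [← colorMonomial_comp_connectedComponentMk]
  rfl

theorem finite_colorMonomial_eq {V : Type*} [Fintype V] (m : ℕ+ →₀ ℕ) :
    Set.Finite {κ : V → ℕ+ | colorMonomial κ = m} := by
  have := finite_colorings (⊥ : SimpleGraph V) m
  refine (Set.finite_range fun κ : {κ : (⊥ : SimpleGraph V).Coloring ℕ+ //
    colorMonomial (fun v => κ v) = m} => fun v => κ.1 v).subset fun κ hκ => ?_
  exact ⟨⟨Coloring.mk κ fun h => h.elim, hκ⟩, rfl⟩

theorem csf_apply {V : Type*} [Fintype V] (G : SimpleGraph V) (m : ℕ+ →₀ ℕ) :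
    csf G m =
      Nat.card {κ : V → ℕ+ // (∀ u v, G.Adj u v → κ u ≠ κ v) ∧ colorMonomial κ = m} := by
  refine congrArg Nat.cast (Nat.card_congr ⟨fun κ => ⟨fun v => κ.1 v, fun u v h => κ.1.valid h,
    κ.2⟩, fun κ => ⟨Coloring.mk κ.1 fun h => κ.2.1 _ _ h, κ.2.2⟩, fun κ => rfl, fun κ => rfl⟩)

/-- The expansion of the chromatic symmetric function in power sums. -/
theorem csf_eq_sum_powerSum {V : Type*} [Fintype V] {n : ℕ} (hn : Fintype.card V = n)
    (G : SimpleGraph V) [Fintype G.edgeSet] :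
    csf G = ∑ S ∈ G.edgeFinset.powerset,
      (-1 : ℚ) ^ S.card • powerSum (part (fromEdgeSet (S : Set (Sym2 V))) hn) := by
  classical
  refine MvPowerSeries.ext fun m => ?_
  rw [map_sum]
  simp only [map_smul, smul_eq_mul]
  change csf G m = ∑ S ∈ G.edgeFinset.powerset,
    (-1 : ℚ) ^ S.card * powerSum (part (fromEdgeSet (S : Set (Sym2 V))) hn) m
  set A : Finset (V → ℕ+) := (finite_colorMonomial_eq m).toFinset
  have hA : ∀ κ, κ ∈ A ↔ colorMonomial κ = m := fun κ => by simp [A]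
  have hcard : ∀ P : (V → ℕ+) → Prop, (Nat.card {κ : V → ℕ+ // P κ ∧ colorMonomial κ = m} : ℚ) =
      ∑ κ ∈ A, if P κ then 1 else 0 := fun P => by
    rw [Finset.sum_boole, Nat.card_congr (Equiv.subtypeEquivRight
      (q := fun κ => κ ∈ A.filter P) fun κ => by simp [hA, and_comm]),
      Nat.card_eq_fintype_card, Fintype.card_coe]
  let mono : (V → ℕ+) → Sym2 V → Prop := fun κ e => (e.map κ).IsDiag
  have hS : ∀ S ⊆ G.edgeFinset, ∀ κ : V → ℕ+,
      (∀ u v, (fromEdgeSet (S : Set (Sym2 V))).Adj u v → κ u = κ v) ↔ ∀ e ∈ S, mono κ e := by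
    intro S hS κ
    constructor
    · intro h e he
      induction e with
      | _ u v =>
        refine h u v ((fromEdgeSet_adj _).mpr ⟨he, ?_⟩)
        exact (mem_edgeFinset.mp (hS he) : G.Adj u v).ne
    · intro h u v huv
      exact h s(u, v) ((fromEdgeSet_adj _).mp huv).1
  have hG : ∀ κ : V → ℕ+, (∀ u v, G.Adj u v → κ u ≠ κ v) ↔ ∀ e ∈ G.edgeFinset, ¬ mono κ e := by
    intro κ
    constructor
    · intro h e he
      induction e with
      | _ u v => exact h u v (mem_edgeFinset.mp he)
    · intro h u v huv
      exact h s(u, v) (mem_edgeFinset.mpr huv)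
  simp only [powerSum_part_apply, hcard, Finset.mul_sum, csf_apply]
  rw [Finset.sum_comm]
  have hite : ∀ {P Q : Prop} (_ : Decidable P) (_ : Decidable Q), (P ↔ Q) →
      (if P then (1 : ℚ) else 0) = if Q then 1 else 0 := fun _ _ h => if_congr h rfl rfl
  refine Finset.sum_congr rfl fun κ _ => ?_
  -- Inclusion–exclusion: properness is a product over edges, and expanding it gives one term per
  -- set of edges required to be monochromatic.
  have hprod : ∏ e ∈ G.edgeFinset, (1 - if mono κ e then (1 : ℚ) else 0) =
      if ∀ u v, G.Adj u v → κ u ≠ κ v then 1 else 0 := by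
    refine (Finset.prod_congr rfl fun e _ => ?_).trans ((Finset.prod_boole (s := G.edgeFinset)
      (p := fun e => ¬ mono κ e)).trans (hite _ _ (hG κ).symm))
    by_cases h : mono κ e <;> simp [h]
  refine Eq.trans ?_ (hprod.symm.trans ?_)
  · congr
  rw [Finset.prod_sub]
  refine Finset.sum_congr rfl fun S hS' => ?_
  rw [Finset.prod_const_one, mul_one, Finset.prod_boole]
  exact congrArg _ (hite _ _ (hS S (Finset.mem_powerset.mp hS') κ).symm)

end Graph

/-! ### Counting components of forests; the leading term. -/

section Forest

open SimpleGraph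

/-- A connection either can avoid the edge, or needs it just once, in one of two directions. -/
theorem reachable_deleteEdges_of_reachable {V : Type*} {G : SimpleGraph V} {u v a b : V}
    (h : G.Reachable a b) :
    (G.deleteEdges {s(u, v)}).Reachable a b ∨
      ((G.deleteEdges {s(u, v)}).Reachable a u ∧ (G.deleteEdges {s(u, v)}).Reachable v b) ∨
      ((G.deleteEdges {s(u, v)}).Reachable a v ∧ (G.deleteEdges {s(u, v)}).Reachable u b) := by
  obtain ⟨p⟩ := h
  induction p with
  | nil => exact Or.inl (Reachable.refl _)
  | @cons a w b h _ ih =>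
    by_cases he : s(a, w) = s(u, v)
    · rcases Sym2.eq_iff.mp he with ⟨rfl, rfl⟩ | ⟨rfl, rfl⟩
      · rcases ih with ih | ⟨-, ih⟩ | ⟨-, ih⟩
        · exact Or.inr (Or.inl ⟨Reachable.refl _, ih⟩)
        · exact Or.inr (Or.inl ⟨Reachable.refl _, ih⟩)
        · exact Or.inl ih
      · rcases ih with ih | ⟨-, ih⟩ | ⟨-, ih⟩
        · exact Or.inr (Or.inr ⟨Reachable.refl _, ih⟩)
        · exact Or.inl ih
        · exact Or.inr (Or.inr ⟨Reachable.refl _, ih⟩)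
    · have haw : (G.deleteEdges {s(u, v)}).Reachable a w :=
        (deleteEdges_adj.mpr ⟨h, he⟩ : (G.deleteEdges {s(u, v)}).Adj a w).reachable
      exact ih.imp haw.trans (Or.imp (And.imp_left haw.trans) (And.imp_left haw.trans))

theorem card_connectedComponent_deleteEdges_of_isBridge {V : Type*} [Finite V]
    {G : SimpleGraph V} {u v : V} (huv : G.Adj u v) (hb : G.IsBridge s(u, v)) :
    Nat.card (G.deleteEdges {s(u, v)}).ConnectedComponent = Nat.card G.ConnectedComponent + 1 := by
  classical
  set H := G.deleteEdges {s(u, v)} with hH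
  have hle : H ≤ G := deleteEdges_le _
  have := Fintype.ofFinite H.ConnectedComponent
  -- The component of `v` is the extra one: in `G` it merges with that of `u`.
  have hbij : Function.Bijective fun c : {c : H.ConnectedComponent // c ≠ H.connectedComponentMk v}
      => c.1.map (Hom.ofLE hle) := by
    constructor
    · rintro ⟨c, hc⟩ ⟨d, hd⟩ hcd
      induction c using ConnectedComponent.ind with | _ a => ?_
      induction d using ConnectedComponent.ind with | _ b => ?_
      have hab : G.Reachable a b := ConnectedComponent.exact hcd
      refine Subtype.ext (ConnectedComponent.sound ?_)
      rcases reachable_deleteEdges_of_reachable (u := u) (v := v) hab with h | ⟨-, h⟩ | ⟨h, -⟩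
      · exact h
      · exact (hd (ConnectedComponent.sound h.symm)).elim
      · exact (hc (ConnectedComponent.sound h)).elim
    · intro c
      induction c using ConnectedComponent.ind with | _ a => ?_
      by_cases ha : H.Reachable a v
      · refine ⟨⟨H.connectedComponentMk u, fun h => hb (ConnectedComponent.exact h)⟩, ?_⟩
        exact ConnectedComponent.sound (huv.reachable.trans (ha.mono hle).symm)
      · exact ⟨⟨H.connectedComponentMk a, fun h => ha (ConnectedComponent.exact h)⟩, rfl⟩
  rw [← Nat.card_congr (Equiv.ofBijective _ hbij), Nat.card_eq_fintype_card,
    Nat.card_eq_fintype_card, Fintype.card_subtype_compl, Fintype.card_subtype_eq]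
  have : 0 < Fintype.card H.ConnectedComponent :=
    Fintype.card_pos_iff.mpr ⟨H.connectedComponentMk v⟩
  omega

/-- A forest has as many edges and components together as it has vertices. -/
theorem _root_.SimpleGraph.IsAcyclic.ncard_edgeSet_add_card_connectedComponent {V : Type*}
    [Finite V] {G : SimpleGraph V} (hG : G.IsAcyclic) :
    G.edgeSet.ncard + Nat.card G.ConnectedComponent = Nat.card V := by
  induction hk : G.edgeSet.ncard generalizing G with
  | zero =>
    rw [Set.ncard_eq_zero, edgeSet_eq_empty] at hk
    subst hk
    rw [zero_add]
    refine (Nat.card_congr (Equiv.ofBijective (⊥ : SimpleGraph V).connectedComponentMk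
      ⟨fun a b h => ?_, Quot.mk_surjective⟩)).symm
    exact reachable_bot.mp (ConnectedComponent.exact h)
  | succ k ih =>
    obtain ⟨e, he⟩ : G.edgeSet.Nonempty := Set.nonempty_of_ncard_ne_zero (by omega)
    induction e with | _ u v => ?_
    have hb := isAcyclic_iff_forall_isBridge.mp hG he
    have hk' : (G.deleteEdges {s(u, v)}).edgeSet.ncard = k := by
      rw [edgeSet_deleteEdges, Set.ncard_sdiff_singleton_of_mem he, hk, Nat.add_sub_cancel]
    have := ih (hG.anti (deleteEdges_le _)) hk'
    rw [card_connectedComponent_deleteEdges_of_isBridge he hb] at this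
    omega

theorem fromEdgeSet_le_of_subset_edgeFinset {V : Type*} {G : SimpleGraph V} [Fintype G.edgeSet]
    {S : Finset (Sym2 V)} (hS : S ⊆ G.edgeFinset) : fromEdgeSet (S : Set (Sym2 V)) ≤ G := by
  intro u v h
  exact mem_edgeFinset.mp (hS ((fromEdgeSet_adj _).mp h).1)

theorem csf_mem_span_powerSum {V : Type*} [Fintype V] {n : ℕ} (hn : Fintype.card V = n)
    (G : SimpleGraph V) :
    csf G ∈ Submodule.span ℚ (powerSum '' {ν | IsFiner ν (part G hn)}) := by
  classical
  rw [csf_eq_sum_powerSum hn]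
  refine Submodule.sum_mem _ fun S hS => Submodule.smul_mem _ _ (Submodule.subset_span
    ⟨_, isFiner_part_of_le hn ?_, rfl⟩)
  exact fromEdgeSet_le_of_subset_edgeFinset (Finset.mem_powerset.mp hS)

/-- In the power sum expansion of a forest of type `lam`, the leading term is `± p_lam`. -/
theorem csf_sub_powerSum_mem_span {V : Type*} [Fintype V] {n : ℕ} (hn : Fintype.card V = n)
    {F : SimpleGraph V} (hF : F.IsAcyclic) :
    csf F - (-1 : ℚ) ^ (n - (part F hn).parts.card) • powerSum (part F hn) ∈
      Submodule.span ℚ (powerSum '' {ν | IsFiner ν (part F hn) ∧ ν ≠ part F hn}) := by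
  classical
  have hcard := hF.ncard_edgeSet_add_card_connectedComponent
  rw [Nat.card_eq_fintype_card (α := V), hn, ← card_parts_part hn,
    Set.ncard_eq_toFinset_card', ← edgeFinset] at hcard
  rw [csf_eq_sum_powerSum hn, ← Finset.add_sum_erase _ _ (Finset.mem_powerset_self _),
    coe_edgeFinset, fromEdgeSet_edgeSet, show n - (part F hn).parts.card = F.edgeFinset.card by
      omega, add_sub_cancel_left]
  refine Submodule.sum_mem _ fun S hS => Submodule.smul_mem _ _ (Submodule.subset_span
    ⟨_, ⟨isFiner_part_of_le hn ?_, fun h => ?_⟩, rfl⟩)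
  all_goals
    obtain ⟨hne, hS⟩ := Finset.mem_erase.mp hS
    rw [Finset.mem_powerset] at hS
    have hle : fromEdgeSet (S : Set (Sym2 V)) ≤ F := fromEdgeSet_le_of_subset_edgeFinset hS
  · exact hle
  -- Equal partitions give equally many components, hence equally many edges, impossible for a
  -- proper subset.
  · have hcard' := (hF.anti hle).ncard_edgeSet_add_card_connectedComponent
    rw [Nat.card_eq_fintype_card (α := V), hn, ← card_parts_part hn, h] at hcard'
    have hlt := Finset.card_lt_card (hS.ssubset_of_ne hne)
    rw [edgeSet_fromEdgeSet, sdiff_eq_left.mpr, Set.ncard_coe_finset] at hcard'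
    · omega
    · rw [Set.disjoint_left]
      intro e he
      exact F.not_isDiag_of_mem_edgeSet (mem_edgeFinset.mp (hS he))

end Forest

/-! ### Inverting the triangular system. -/

namespace ChromaticBasis

variable {n : ℕ} {B : ChromaticBasis.{u} n}

theorem IsForestBasis.elt_sub_powerSum_mem_span (hB : B.IsForestBasis) (lam : n.Partition) :
    B.elt lam - (-1 : ℚ) ^ (n - lam.parts.card) • powerSum lam ∈
      Submodule.span ℚ (powerSum '' {ν | IsFiner ν lam ∧ ν ≠ lam}) := by
  have := csf_sub_powerSum_mem_span (B.card_V lam) (hB lam)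
  rwa [B.part_graph] at this

/-- Solve for the leading term, whose coefficient is a unit; the remaining power sums have more
parts, so induction on `n - ℓ(lam)` applies. -/
theorem IsForestBasis.powerSum_mem_span (hB : B.IsForestBasis) (lam : n.Partition) :
    powerSum lam ∈ Submodule.span ℚ (B.elt '' {ν | IsFiner ν lam}) := by
  induction hk : n - lam.parts.card using Nat.strong_induction_on generalizing lam with
  | _ k ih =>
    subst hk
    have hsub : Submodule.span ℚ (powerSum '' {ν | IsFiner ν lam ∧ ν ≠ lam}) ≤
        Submodule.span ℚ (B.elt '' {ν | IsFiner ν lam}) := by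
      rw [Submodule.span_le]
      rintro _ ⟨ν, ⟨hν, hne⟩, rfl⟩
      have hlt := hν.eq_or_card_lt.resolve_left hne
      have hle : ν.parts.card ≤ n := by
        simpa [ν.parts_sum] using ν.parts.card_nsmul_le_sum (a := 1) fun _ h => ν.parts_pos h
      exact Submodule.span_mono (Set.image_mono fun ρ hρ => hρ.trans hν)
        (ih _ (by omega) ν rfl)
    have hX : B.elt lam ∈ Submodule.span ℚ (B.elt '' {ν | IsFiner ν lam}) :=
      Submodule.subset_span ⟨lam, IsFiner.refl lam, rfl⟩
    have h := Submodule.sub_mem _ hX (hsub (hB.elt_sub_powerSum_mem_span lam))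
    rwa [sub_sub_cancel, Submodule.smul_mem_iff _ (pow_ne_zero _ (by norm_num))] at h

/-- The family spans at least the span of the equally many independent power sums. -/
theorem IsForestBasis.linearIndependent (hB : B.IsForestBasis) :
    LinearIndependent ℚ B.elt := by
  rw [linearIndependent_iff_card_le_finrank_span,
    linearIndependent_iff_card_eq_finrank_span.mp (linearIndependent_powerSum n)]
  have := Module.Finite.span_of_finite ℚ (Set.finite_range B.elt)
  refine Submodule.finrank_mono (Submodule.span_le.mpr ?_)
  rintro _ ⟨lam, rfl⟩
  exact Submodule.span_mono (Set.image_subset_range _ _) (hB.powerSum_mem_span lam)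

/-- Elements of the span of part of the family have coefficients supported on that part. -/
theorem exists_coeff_of_mem_span {s : Set n.Partition} {x : MvPowerSeries ℕ+ ℚ}
    (hx : x ∈ Submodule.span ℚ (B.elt '' s)) :
    ∃ c : n.Partition → ℚ, x = ∑ μ, c μ • B.elt μ ∧ ∀ μ, c μ ≠ 0 → μ ∈ s := by
  obtain ⟨l, hl, rfl⟩ := (Finsupp.mem_span_image_iff_linearCombination ℚ).mp hx
  refine ⟨l, ?_, fun μ hμ => hl (Finsupp.mem_support_iff.mpr hμ)⟩
  rw [Finsupp.linearCombination_apply, Finsupp.sum_fintype _ _ (by simp)]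

theorem isExpansion_coeff {V : Type v} [Fintype V] {G : SimpleGraph V} {c : n.Partition → ℚ}
    (hc : B.IsExpansion G c) : B.IsExpansion G fun μ => B.coeff G μ := by
  have h : ∃ c, B.IsExpansion G c := ⟨c, hc⟩
  simpa only [coeff, dif_pos h] using h.choose_spec

theorem IsForestBasis.coeff_eq (hB : B.IsForestBasis) {V : Type v} [Fintype V]
    {G : SimpleGraph V} {c : n.Partition → ℚ} (hc : B.IsExpansion G c) (μ : n.Partition) :
    B.coeff G μ = c μ := by
  have h := (isExpansion_coeff hc).symm.trans hc
  exact congrFun (hB.linearIndependent.fintypeLinearCombination_injective h) μ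

theorem IsForestBasis.span_powerSum_le (hB : B.IsForestBasis) {s : Set n.Partition}
    (hs : ∀ ν ∈ s, ∀ ρ, IsFiner ρ ν → ρ ∈ s) :
    Submodule.span ℚ (powerSum '' s) ≤ Submodule.span ℚ (B.elt '' s) := by
  rw [Submodule.span_le]
  rintro _ ⟨ν, hν, rfl⟩
  exact Submodule.span_mono (Set.image_mono fun ρ hρ => hs ν hν ρ hρ) (hB.powerSum_mem_span ν)

end ChromaticBasis
end ForestBasis

theorem mainTheorem10 {n : ℕ} (B : ForestBasis.ChromaticBasis.{u} n) (hB : B.IsForestBasis)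
    {V : Type v} [Fintype V] (G : SimpleGraph V) (hn : Fintype.card V = n) :
    (LinearIndependent ℚ B.elt ∧ B.IsExpansion G (fun μ => B.coeff G μ)) ∧
    (∀ μ : n.Partition, B.coeff G μ ≠ 0 → ForestBasis.IsFiner μ (ForestBasis.part G hn)) ∧
    (G.IsAcyclic → B.coeff G (ForestBasis.part G hn) = 1) := by
  obtain ⟨c, hc, hsupp⟩ := ForestBasis.ChromaticBasis.exists_coeff_of_mem_span
    (hB.span_powerSum_le (s := {ν | ForestBasis.IsFiner ν (ForestBasis.part G hn)})
      (fun _ hν _ hρ => hρ.trans hν)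
      (ForestBasis.csf_mem_span_powerSum hn G))
  have hc : B.IsExpansion G c := hc
  refine ⟨⟨hB.linearIndependent, ForestBasis.ChromaticBasis.isExpansion_coeff hc⟩,
    fun μ hμ => hsupp μ (hB.coeff_eq hc μ ▸ hμ), fun hG => ?_⟩
  set lam := ForestBasis.part G hn with hlam
  -- The leading sign depends only on `lam`, so it cancels between `X_F` and `X_{G_lam}`.
  have hdiff := Submodule.sub_mem _ (ForestBasis.csf_sub_powerSum_mem_span hn hG)
    (hB.elt_sub_powerSum_mem_span lam)
  rw [← hlam, sub_sub_sub_cancel_right] at hdiff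
  obtain ⟨d, hd, hdsupp⟩ := ForestBasis.ChromaticBasis.exists_coeff_of_mem_span
    (hB.span_powerSum_le (s := {ν | ForestBasis.IsFiner ν lam ∧ ν ≠ lam})
      -- Being strictly finer than `lam` is downward closed: part counts exclude two distinct
      -- partitions each finer than the other.
      (fun ν hν ρ hρ => ⟨hρ.trans hν.1, fun h => hν.2 (by
      subst h
      refine hν.1.eq_or_card_lt.resolve_right fun hlt => ?_
      rcases hρ.eq_or_card_lt with h | h
      · rw [h] at hlt
        exact lt_irrefl _ hlt
      · omega)⟩) hdiff)
  have hd' : B.IsExpansion G (d + Pi.single lam 1) := by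
    rw [ForestBasis.ChromaticBasis.IsExpansion, eq_add_of_sub_eq hd]
    simp [add_smul, Finset.sum_add_distrib, Pi.single_apply]
  have hd0 : d lam = 0 := by
    by_contra h
    exact (hdsupp lam h).2 rfl
  rw [hB.coeff_eq hd' lam]
  simp [hd0]
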